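/- There is an absolute constant $C$ such that the following holds. Let $X,Y,A,B$ be jointly distributed discrete random variables (each taking values in a finite or countable set) with finite joint Shannon entropy, and let $0\le\varepsilon\le\tfrac12$ be such that $$\max\{I(A:X\mid Y),\ I(A:Y\mid X),\ I(B:X\mid Y),\ I(B:Y\mid X)\}\le\varepsilon\cdot I(X:Y).$$ Then $$I(X:Y)\le I(X:Y\mid A)+I(X:Y\mid B)+I(A:B)+C\,\varepsilon\log(1/\varepsilon)\cdot I(X:Y),$$ where $I(\cdot:\cdot)$ and $I(\cdot:\cdot\mid\cdot)$ denote Shannon mutual information and conditional mutual information, and $\varepsilon\log(1/\varepsilon)$ is read as $0$ for $\varepsilon=0$. -/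

import Mathlib

open MeasureTheory

namespace DiscreteInfo

noncomputable section

/-- The random variable `X` on the probability space `(Ω, μ)`, with values in a countable set,
has finite Shannon entropy: `∑ₛ -P(X = s) log P(X = s) < ∞`. -/
def HasFiniteEntropy {Ω S : Type*} [MeasurableSpace Ω] (μ : Measure Ω) (X : Ω → S) : Prop :=
  Summable fun s : S => Real.negMulLog (μ.real (X ⁻¹' {s}))

/-- The Shannon entropy `H(X) = ∑ₛ -P(X = s) log P(X = s)` (natural logarithm). -/
def entropy {Ω S : Type*} [MeasurableSpace Ω] (μ : Measure Ω) (X : Ω → S) : ℝ :=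
  ∑' s : S, Real.negMulLog (μ.real (X ⁻¹' {s}))

/-- The conditional entropy `H(X | Y) = H(X, Y) - H(Y)`. -/
def condEntropy {Ω S T : Type*} [MeasurableSpace Ω] (μ : Measure Ω)
    (X : Ω → S) (Y : Ω → T) : ℝ :=
  entropy μ (fun ω => (X ω, Y ω)) - entropy μ Y

/-- The mutual information `I(X : Y) = H(X) - H(X | Y)`. -/
def mutualInfo {Ω S T : Type*} [MeasurableSpace Ω] (μ : Measure Ω)
    (X : Ω → S) (Y : Ω → T) : ℝ :=
  entropy μ X - condEntropy μ X Y

/-- The conditional mutual information `I(X : Y | Z) = H(X | Z) - H(X | Y, Z)`. -/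
def condMutualInfo {Ω S T U : Type*} [MeasurableSpace Ω] (μ : Measure Ω)
    (X : Ω → S) (Y : Ω → T) (Z : Ω → U) : ℝ :=
  condEntropy μ X Z - condEntropy μ X (fun ω => (Y ω, Z ω))

end

end DiscreteInfo

/-! Write D for the Ingleton defect `I(X:Y) - I(X:Y|A) - I(X:Y|B) - I(A:B)` and m(Z) for the Markov
defect `I(Z:X|Y) + I(Z:Y|X)`. The hypothesis gives m(A), m(B) ≤ 2εI with I = I(X:Y), and the goal is
D = O(ε log(1/ε)) I.

If Z is conditionally independent of (A, B) given (X, Y), Shannon inequalities give `D + I(X:Y|ZA) +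
I(X:Y|ZB) ≤ I(X:Y|Z) + m(Z)` (`ingletonDefect_le_cond`), and m(ZA) ≤ m(Z) + m(A)
(`markovDefect_pair_le`). The joint laws of (Z, A) and of (Z, B) with (X, Y) can be realised afresh
by a variable conditionally independent of (A, B), so the inequality applies again to each of them.

Starting from a constant Z, this grows a binary tree. A node at depth k has Markov defect at most
2kεI, and depth n yields `(2^n - 1) D ≤ I + n 2^n · 2εI` (`ingletonDefect_doubling`). Taking 2^n ≈
1/ε finishes the proof (`le_mul_log_inv_of_doubling`). -/

namespace DiscreteInfo

/-! ### Entropy as an expected surprisal, and submodularity. -/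

section Shannon

variable {Ω S T U V : Type*} [MeasurableSpace Ω] {μ : Measure Ω}
  [Countable S] [MeasurableSpace S] [MeasurableSingletonClass S]
  [Countable T] [MeasurableSpace T] [MeasurableSingletonClass T]
  [Countable U] [MeasurableSpace U] [MeasurableSingletonClass U]
  [Countable V] [MeasurableSpace V] [MeasurableSingletonClass V]

/-- The surprisal `-log P(X = X ω)`, whose expectation is the entropy of `X`. -/
noncomputable def surprisal {Ω S : Type*} [MeasurableSpace Ω] (μ : Measure Ω) (X : Ω → S) (ω : Ω) :
    ℝ :=
  -Real.log (μ.real (X ⁻¹' {X ω}))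

/-- `F` determines `M` when `M` is constant on the fibres of `F`. -/
def Determines {Ω S T : Type*} (F : Ω → S) (M : Ω → T) : Prop :=
  ∀ ω ω', F ω = F ω' → M ω = M ω'

omit [Countable S] [MeasurableSpace S] [MeasurableSingletonClass S] in
lemma surprisal_nonneg [IsProbabilityMeasure μ] (X : Ω → S) (ω : Ω) : 0 ≤ surprisal μ X ω := by
  have := Real.log_nonpos (measureReal_nonneg (μ := μ) (s := X ⁻¹' {X ω})) measureReal_le_one
  simpa [surprisal] using this

/-- The law of `X` is a countable sum of weighted Dirac masses, so the entropy series is the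
expected surprisal. On `Ω` the surprisals of different variables can be compared pointwise. -/
lemma hasFiniteEntropy_iff_integrable [IsProbabilityMeasure μ] {X : Ω → S} (hX : Measurable X) :
    HasFiniteEntropy μ X ↔ Integrable (surprisal μ X) μ := by
  have : Integrable (surprisal μ X) μ ↔
      Integrable (fun s => -Real.log (μ.real (X ⁻¹' {s}))) (μ.map X) := by
    rw [integrable_map_measure (measurable_of_countable _).aestronglyMeasurable hX.aemeasurable]
    rfl
  rw [this, ← Measure.sum_smul_dirac (μ.map X),
    integrable_sum_dirac_iff (fun i => measure_ne_top _ _)]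
  refine summable_congr fun s => ?_
  have h1 := Real.log_nonpos (measureReal_nonneg (μ := μ) (s := X ⁻¹' {s})) measureReal_le_one
  rw [Measure.map_apply hX (measurableSet_singleton s), ← measureReal_def, Real.norm_eq_abs,
    abs_of_nonneg (by linarith), Real.negMulLog]
  ring

lemma entropy_eq_integral [IsProbabilityMeasure μ] {X : Ω → S} (hX : Measurable X) :
    entropy μ X = ∫ ω, surprisal μ X ω ∂μ := by
  have : ∫ ω, surprisal μ X ω ∂μ = ∫ s, -Real.log (μ.real (X ⁻¹' {s})) ∂(μ.map X) := by
    rw [integral_map hX.aemeasurable (measurable_of_countable _).aestronglyMeasurable]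
    rfl
  rw [this, ← Measure.sum_smul_dirac (μ.map X), integral_sum_dirac (fun i => measure_ne_top _ _)]
  refine tsum_congr fun s => ?_
  rw [Measure.map_apply hX (measurableSet_singleton s), ← measureReal_def, Real.negMulLog,
    smul_eq_mul]
  ring

lemma ae_measureReal_fiber_pos [IsProbabilityMeasure μ] {X : Ω → S} (hX : Measurable X) :
    ∀ᵐ ω ∂μ, 0 < μ.real (X ⁻¹' {X ω}) := by
  have h : ∀ᵐ s ∂(μ.map X), 0 < μ.real (X ⁻¹' {s}) := by
    rw [ae_iff_of_countable]
    intro s hs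
    rw [Measure.map_apply hX (measurableSet_singleton s)] at hs
    exact ENNReal.toReal_pos hs (measure_ne_top _ _)
  exact ae_of_ae_map hX.aemeasurable h

lemma measurable_surprisal {X : Ω → S} (hX : Measurable X) : Measurable (surprisal μ X) :=
  (measurable_of_countable fun s => -Real.log (μ.real (X ⁻¹' {s}))).comp hX

/-- Each fibre of `F` lies inside a fibre of `M`, so almost surely the surprisal of `M` is at most
that of `F`. -/
lemma HasFiniteEntropy.of_determines [IsProbabilityMeasure μ] {F : Ω → S} {M : Ω → T}
    (h : HasFiniteEntropy μ F) (hF : Measurable F) (hM : Measurable M) (hFM : Determines F M) :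
    HasFiniteEntropy μ M := by
  rw [hasFiniteEntropy_iff_integrable hF] at h
  rw [hasFiniteEntropy_iff_integrable hM]
  refine h.mono' (measurable_surprisal hM).aestronglyMeasurable ?_
  filter_upwards [ae_measureReal_fiber_pos hF] with ω hω
  rw [Real.norm_eq_abs, abs_of_nonneg (surprisal_nonneg M ω)]
  exact neg_le_neg (Real.log_le_log hω (measureReal_mono fun ω' h' => hFM _ _ h'))

/-- Entropy depends only on the partition of `Ω` into fibres. This disposes of every reordering,
rebracketing and injective recoding of tuples below. -/
lemma entropy_congr [IsProbabilityMeasure μ] {F : Ω → S} {M : Ω → T} (hF : Measurable F)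
    (hM : Measurable M) (h : ∀ ω ω', F ω = F ω' ↔ M ω = M ω') : entropy μ F = entropy μ M := by
  rw [entropy_eq_integral hF, entropy_eq_integral hM]
  congr 1
  ext ω
  have : F ⁻¹' {F ω} = M ⁻¹' {M ω} := by
    ext ω'
    exact h ω' ω
  simp [surprisal, this]

omit [Countable S] in
lemma tsum_measure_pair_fiber {E : Ω → S} (hE : Measurable E) {Z : Ω → T} (hZ : Measurable Z)
    (e : S) : ∑' z, μ ((fun ω => (E ω, Z ω)) ⁻¹' {(e, z)}) = μ (E ⁻¹' {e}) := by
  rw [← measure_iUnion]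
  · congr 1
    ext ω
    simp
  · intro z z' hz
    refine Set.disjoint_left.mpr fun ω h h' => hz ?_
    simp only [Set.mem_preimage, Set.mem_singleton_iff, Prod.mk.injEq] at h h'
    exact h.2.symm.trans h'.2
  · exact fun z => (hE.prodMk hZ) (measurableSet_singleton _)

/-- The likelihood ratio of the conditionally independent coupling of `G` and `Z` over `E`
against their joint law, evaluated at `ω`. -/
noncomputable def couplingRatio {Ω S T U : Type*} [MeasurableSpace Ω] (μ : Measure Ω)
    (E : Ω → S) (G : Ω → T) (Z : Ω → U) (ω : Ω) : ℝ :=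
  μ.real ((fun ω => (E ω, G ω)) ⁻¹' {(E ω, G ω)}) * μ.real ((fun ω => (E ω, Z ω)) ⁻¹' {(E ω, Z ω)})
    / (μ.real ((fun ω => (E ω, G ω, Z ω)) ⁻¹' {(E ω, G ω, Z ω)}) * μ.real (E ⁻¹' {E ω}))

lemma measurable_measureReal_fiber {X : Ω → S} (hX : Measurable X) :
    Measurable fun ω => μ.real (X ⁻¹' {X ω}) :=
  (measurable_of_countable fun s => μ.real (X ⁻¹' {s})).comp hX

lemma measurable_couplingRatio {E : Ω → S} {G : Ω → T} {Z : Ω → U} (hE : Measurable E)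
    (hG : Measurable G) (hZ : Measurable Z) : Measurable (couplingRatio μ E G Z) :=
  ((measurable_measureReal_fiber (hE.prodMk hG)).mul
    (measurable_measureReal_fiber (hE.prodMk hZ))).div
    ((measurable_measureReal_fiber (hE.prodMk (hG.prodMk hZ))).mul (measurable_measureReal_fiber hE))

lemma lintegral_couplingRatio_le_one [IsProbabilityMeasure μ] {E : Ω → S} {G : Ω → T} {Z : Ω → U}
    (hE : Measurable E) (hG : Measurable G) (hZ : Measurable Z) :
    ∫⁻ ω, ENNReal.ofReal (couplingRatio μ E G Z ω) ∂μ ≤ 1 := by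
  set F : Ω → S × T × U := fun ω => (E ω, G ω, Z ω) with hFdef
  have hF : Measurable F := hE.prodMk (hG.prodMk hZ)
  set pe : S → ENNReal := fun e => μ (E ⁻¹' {e})
  set pg : S → T → ENNReal := fun e g => μ ((fun ω => (E ω, G ω)) ⁻¹' {(e, g)})
  set pz : S → U → ENNReal := fun e z => μ ((fun ω => (E ω, Z ω)) ⁻¹' {(e, z)})
  have hsum : ∀ e, ∑' z, pz e z = pe e := tsum_measure_pair_fiber hE hZ
  have hsum' : ∀ e, ∑' g, pg e g = pe e := tsum_measure_pair_fiber hE hG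
  have hone : ∑' e, pe e = 1 := by
    have := tsum_measure_preimage_singleton (μ := μ) (Set.countable_univ (α := S)) (f := E)
      (fun y _ => hE (measurableSet_singleton y))
    rw [Set.preimage_univ, measure_univ, tsum_univ (fun b => μ (E ⁻¹' {b}))] at this
    exact this
  set r : S × T × U → ENNReal := fun s => ENNReal.ofReal
    (μ.real ((fun ω => (E ω, G ω)) ⁻¹' {(s.1, s.2.1)})
      * μ.real ((fun ω => (E ω, Z ω)) ⁻¹' {(s.1, s.2.2)})
      / (μ.real (F ⁻¹' {s}) * μ.real (E ⁻¹' {s.1}))) with hr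
  -- Equality holds on atoms of positive mass. Null atoms contribute nothing on the left but may
  -- contribute on the right, hence only `≤`.
  have hbound : ∀ e g z, r (e, g, z) * μ (F ⁻¹' {(e, g, z)}) ≤ pg e g * (pz e z / pe e) := by
    intro e g z
    rcases eq_or_ne (μ (F ⁻¹' {(e, g, z)})) 0 with h0 | h0
    · simp [h0]
    have hle : μ (F ⁻¹' {(e, g, z)}) ≤ pe e := measure_mono fun ω h => by
      simp only [hFdef, Set.mem_preimage, Set.mem_singleton_iff, Prod.mk.injEq] at h
      exact h.1
    have he : pe e ≠ 0 := fun h => h0 (le_antisymm (h ▸ hle) zero_le)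
    have h1 : 0 < μ.real (F ⁻¹' {(e, g, z)}) := ENNReal.toReal_pos h0 (measure_ne_top _ _)
    have h2 : 0 < μ.real (E ⁻¹' {e}) := ENNReal.toReal_pos he (measure_ne_top _ _)
    apply le_of_eq
    have e1 : pg e g * (pz e z / pe e) = ENNReal.ofReal
        (μ.real ((fun ω => (E ω, G ω)) ⁻¹' {(e, g)})
          * (μ.real ((fun ω => (E ω, Z ω)) ⁻¹' {(e, z)}) / μ.real (E ⁻¹' {e}))) := by
      rw [ENNReal.ofReal_mul measureReal_nonneg, ENNReal.ofReal_div_of_pos h2,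
        ofReal_measureReal, ofReal_measureReal, ofReal_measureReal]
    rw [e1, ← ofReal_measureReal (μ := μ) (s := F ⁻¹' {(e, g, z)}), hr,
      ← ENNReal.ofReal_mul (by positivity)]
    congr 1
    field_simp
  calc ∫⁻ ω, ENNReal.ofReal (couplingRatio μ E G Z ω) ∂μ
      = ∫⁻ s, r s ∂(μ.map F) := by
        rw [lintegral_map (measurable_of_countable _) hF]
        rfl
    _ = ∑' s, r s * μ (F ⁻¹' {s}) := by
        rw [lintegral_countable']
        exact tsum_congr fun s => by rw [Measure.map_apply hF (measurableSet_singleton s)]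
    _ = ∑' e, ∑' g, ∑' z, r (e, g, z) * μ (F ⁻¹' {(e, g, z)}) := by
        rw [ENNReal.tsum_prod']
        exact tsum_congr fun e => ENNReal.tsum_prod'
    _ ≤ ∑' e, ∑' g, ∑' z, pg e g * (pz e z / pe e) :=
        ENNReal.tsum_le_tsum fun e => ENNReal.tsum_le_tsum fun g => ENNReal.tsum_le_tsum fun z =>
          hbound e g z
    _ ≤ ∑' e, ∑' g, pg e g := by
        refine ENNReal.tsum_le_tsum fun e => ENNReal.tsum_le_tsum fun g => ?_
        simp_rw [ENNReal.tsum_mul_left, div_eq_mul_inv, ENNReal.tsum_mul_right, hsum]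
        -- Only `≤ 1` is available, since `pe e` may vanish.
        exact mul_le_of_le_one_right' (ENNReal.mul_inv_le_one _)
    _ = 1 := by simp_rw [hsum', hone]

/-- Gibbs' inequality: integrate `log R ≤ R - 1` for the coupling ratio `R`, whose mean is at most
1. The expectation of `log R` is the left side minus the right side. -/
lemma entropy_add_entropy_le_of_prod [IsProbabilityMeasure μ] {E : Ω → S} {G : Ω → T} {Z : Ω → U}
    (hE : Measurable E) (hG : Measurable G) (hZ : Measurable Z)
    (h : HasFiniteEntropy μ fun ω => (E ω, G ω, Z ω)) :
    entropy μ (fun ω => (E ω, G ω, Z ω)) + entropy μ E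
      ≤ entropy μ (fun ω => (E ω, G ω)) + entropy μ (fun ω => (E ω, Z ω)) := by
  have mEGZ : Measurable fun ω => (E ω, G ω, Z ω) := hE.prodMk (hG.prodMk hZ)
  have mEG : Measurable fun ω => (E ω, G ω) := hE.prodMk hG
  have mEZ : Measurable fun ω => (E ω, Z ω) := hE.prodMk hZ
  have iE := (hasFiniteEntropy_iff_integrable hE).1
    (h.of_determines mEGZ hE fun ω ω' h => by simp_all)
  have iEG := (hasFiniteEntropy_iff_integrable mEG).1
    (h.of_determines mEGZ mEG fun ω ω' h => by simp_all)
  have iEZ := (hasFiniteEntropy_iff_integrable mEZ).1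
    (h.of_determines mEGZ mEZ fun ω ω' h => by simp_all)
  have iEGZ := (hasFiniteEntropy_iff_integrable mEGZ).1 h
  have hR0 : ∀ ω, 0 ≤ couplingRatio μ E G Z ω := fun ω => by unfold couplingRatio; positivity
  have hRle := lintegral_couplingRatio_le_one (μ := μ) hE hG hZ
  have hRm := measurable_couplingRatio (μ := μ) hE hG hZ
  have iR : Integrable (couplingRatio μ E G Z) μ :=
    ⟨hRm.aestronglyMeasurable, by
      rw [hasFiniteIntegral_iff_ofReal (ae_of_all _ hR0)]
      exact hRle.trans_lt ENNReal.one_lt_top⟩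
  have hR1 : ∫ ω, couplingRatio μ E G Z ω ∂μ ≤ 1 := by
    rw [integral_eq_lintegral_of_nonneg_ae (ae_of_all _ hR0) hRm.aestronglyMeasurable]
    exact ENNReal.toReal_le_of_le_ofReal zero_le_one (by simpa using hRle)
  have key : ∫ ω, (surprisal μ (fun ω => (E ω, G ω, Z ω)) ω + surprisal μ E ω) ∂μ
      ≤ ∫ ω, ((surprisal μ (fun ω => (E ω, G ω)) ω + surprisal μ (fun ω => (E ω, Z ω)) ω)
          + (couplingRatio μ E G Z ω - 1)) ∂μ := by
    refine integral_mono_ae (iEGZ.add iE) ((iEG.add iEZ).add (iR.sub (integrable_const 1))) ?_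
    filter_upwards [ae_measureReal_fiber_pos hE, ae_measureReal_fiber_pos mEG,
      ae_measureReal_fiber_pos mEZ, ae_measureReal_fiber_pos mEGZ] with ω h1 h2 h3 h4
    have := Real.log_le_sub_one_of_pos (x := couplingRatio μ E G Z ω)
      (by unfold couplingRatio; positivity)
    have h5 : Real.log (couplingRatio μ E G Z ω) = _ :=
      (Real.log_div (mul_pos h2 h3).ne' (mul_pos h4 h1).ne').trans
        (by rw [Real.log_mul h2.ne' h3.ne', Real.log_mul h4.ne' h1.ne'])
    simp only [surprisal]
    linarith
  have i2 : Integrable (fun ω => surprisal μ (fun ω => (E ω, G ω)) ω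
      + surprisal μ (fun ω => (E ω, Z ω)) ω) μ := iEG.add iEZ
  have i3 : Integrable (fun ω => couplingRatio μ E G Z ω - 1) μ := iR.sub (integrable_const 1)
  rw [integral_add iEGZ iE, integral_add i2 i3,
    integral_add iEG iEZ, integral_sub iR (integrable_const 1)] at key
  rw [entropy_eq_integral hE, entropy_eq_integral mEG, entropy_eq_integral mEZ,
    entropy_eq_integral mEGZ]
  simp only [integral_const, probReal_univ, smul_eq_mul, mul_one] at key
  linarith

/-- Submodularity of entropy: `U` is the join of `F` and `G`, and both determine `M`. -/
lemma entropy_submodular [IsProbabilityMeasure μ] {F : Ω → S} {G : Ω → T} {J : Ω → U} {M : Ω → V}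
    (h : HasFiniteEntropy μ J) (hF : Measurable F) (hG : Measurable G) (hJ : Measurable J)
    (hM : Measurable M) (hJFG : ∀ ω ω', J ω = J ω' ↔ F ω = F ω' ∧ G ω = G ω')
    (hFM : Determines F M) (hGM : Determines G M) :
    entropy μ J + entropy μ M ≤ entropy μ F + entropy μ G := by
  -- Adjoining `M` to `F`, `G` and `J` changes no fibres and brings the claim to product form.
  have mMFG : Measurable fun ω => (M ω, F ω, G ω) := hM.prodMk (hF.prodMk hG)
  have := entropy_add_entropy_le_of_prod hM hF hG (h.of_determines hJ mMFG fun ω ω' h => by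
    obtain ⟨h1, h2⟩ := (hJFG ω ω').1 h
    simp [h1, h2, hFM ω ω' h1])
  rwa [entropy_congr mMFG hJ, entropy_congr (hM.prodMk hF) hF, entropy_congr (hM.prodMk hG) hG]
    at this
  · exact fun ω ω' => by simpa using hGM ω ω'
  · exact fun ω ω' => by simpa using hFM ω ω'
  · intro ω ω'
    rw [hJFG]
    simpa using fun h1 _ => hFM ω ω' h1

/-- If the conditional law of `Z` given `(E, G)` is a function `r` of `E` alone, then `Z` and `G`
are conditionally independent given `E`, so that the submodularity inequality is an equality. -/
lemma entropy_add_entropy_eq_of_condLaw [IsProbabilityMeasure μ] {E : Ω → S} {G : Ω → T} {Z : Ω → U}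
    (hE : Measurable E) (hG : Measurable G) (hZ : Measurable Z) (r : S → U → ℝ)
    (hEZ : ∀ e z, μ.real ((fun ω => (E ω, Z ω)) ⁻¹' {(e, z)}) = μ.real (E ⁻¹' {e}) * r e z)
    (hEGZ : ∀ e g z, μ.real ((fun ω => (E ω, G ω, Z ω)) ⁻¹' {(e, g, z)})
      = μ.real ((fun ω => (E ω, G ω)) ⁻¹' {(e, g)}) * r e z)
    (h1 : HasFiniteEntropy μ fun ω => (E ω, G ω)) (h2 : HasFiniteEntropy μ fun ω => (E ω, Z ω)) :
    HasFiniteEntropy μ (fun ω => (E ω, G ω, Z ω)) ∧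
      entropy μ (fun ω => (E ω, G ω, Z ω)) + entropy μ E
        = entropy μ (fun ω => (E ω, G ω)) + entropy μ (fun ω => (E ω, Z ω)) := by
  have mEGZ : Measurable fun ω => (E ω, G ω, Z ω) := hE.prodMk (hG.prodMk hZ)
  have mEG : Measurable fun ω => (E ω, G ω) := hE.prodMk hG
  have mEZ : Measurable fun ω => (E ω, Z ω) := hE.prodMk hZ
  have iE := (hasFiniteEntropy_iff_integrable hE).1
    (h1.of_determines mEG hE fun ω ω' h => by simp_all)
  have iEG := (hasFiniteEntropy_iff_integrable mEG).1 h1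
  have iEZ := (hasFiniteEntropy_iff_integrable mEZ).1 h2
  have key : surprisal μ (fun ω => (E ω, G ω, Z ω)) =ᵐ[μ] fun ω =>
      surprisal μ (fun ω => (E ω, G ω)) ω + surprisal μ (fun ω => (E ω, Z ω)) ω
        - surprisal μ E ω := by
    filter_upwards [ae_measureReal_fiber_pos hE, ae_measureReal_fiber_pos mEG,
      ae_measureReal_fiber_pos mEZ] with ω p1 p2 p3
    simp only [surprisal]
    rw [hEZ] at p3 ⊢
    have p4 : r (E ω) (Z ω) ≠ 0 := fun h => by simp [h] at p3
    rw [hEGZ, Real.log_mul p1.ne' p4, Real.log_mul p2.ne' p4]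
    ring
  have i2 : Integrable (fun ω => surprisal μ (fun ω => (E ω, G ω)) ω
      + surprisal μ (fun ω => (E ω, Z ω)) ω) μ := iEG.add iEZ
  have hi : Integrable (fun ω =>
      surprisal μ (fun ω => (E ω, G ω)) ω + surprisal μ (fun ω => (E ω, Z ω)) ω
        - surprisal μ E ω) μ := (iEG.add iEZ).sub iE
  refine ⟨(hasFiniteEntropy_iff_integrable mEGZ).2 (hi.congr key.symm), ?_⟩
  rw [entropy_eq_integral hE, entropy_eq_integral mEG, entropy_eq_integral mEZ,
    entropy_eq_integral mEGZ, integral_congr_ae key, integral_sub i2 iE,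
    integral_add iEG iEZ]
  ring

lemma entropy_const [IsProbabilityMeasure μ] (s : S) : entropy μ (fun _ => s) = 0 := by
  rw [entropy_eq_integral measurable_const]
  simp [surprisal]

end Shannon

/-! ### The two Shannon-type inequalities behind the doubling step. -/

section Inequalities

variable {Ω R S T U V : Type*} [MeasurableSpace Ω] {μ : Measure Ω} [IsProbabilityMeasure μ]
  [Countable R] [MeasurableSpace R] [MeasurableSingletonClass R]
  [Countable S] [MeasurableSpace S] [MeasurableSingletonClass S]
  [Countable T] [MeasurableSpace T] [MeasurableSingletonClass T]
  [Countable U] [MeasurableSpace U] [MeasurableSingletonClass U]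
  [Countable V] [MeasurableSpace V] [MeasurableSingletonClass V]

lemma condMutualInfo_nonneg {X : Ω → S} {Y : Ω → T} {Z : Ω → U} (hX : Measurable X)
    (hY : Measurable Y) (hZ : Measurable Z) (h : HasFiniteEntropy μ fun ω => (X ω, Y ω, Z ω)) :
    0 ≤ condMutualInfo μ X Y Z := by
  have := entropy_submodular (F := fun ω => (X ω, Z ω)) (G := fun ω => (Y ω, Z ω)) (M := Z) h
    (by fun_prop) (by fun_prop) (by fun_prop) hZ
    (fun ω ω' => by simp; tauto) (fun ω ω' h => by simp_all) (fun ω ω' h => by simp_all)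
  unfold condMutualInfo condEntropy
  linarith

/-- The total conditional dependence of `Z` on one of `X`, `Y` given the other: it vanishes for
every function of both `X` and `Y` separately. -/
noncomputable def markovDefect {Ω S T U : Type*} [MeasurableSpace Ω] (μ : Measure Ω) (X : Ω → S)
    (Y : Ω → T) (Z : Ω → U) : ℝ :=
  condMutualInfo μ Z X Y + condMutualInfo μ Z Y X

/-- The amount by which `X, Y, A, B` violate the Ingleton inequality. -/
noncomputable def ingletonDefect {Ω S T U V : Type*} [MeasurableSpace Ω] (μ : Measure Ω) (X : Ω → S)
    (Y : Ω → T) (A : Ω → U) (B : Ω → V) : ℝ :=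
  mutualInfo μ X Y - condMutualInfo μ X Y A - condMutualInfo μ X Y B - mutualInfo μ A B

/-- If `Z` and `A` are conditionally independent given `(X, Y)`, the Markov defect is subadditive. -/
lemma markovDefect_pair_le {X : Ω → S} {Y : Ω → T} {A : Ω → U} {Z : Ω → V} (hX : Measurable X)
    (hY : Measurable Y) (hA : Measurable A) (hZ : Measurable Z)
    (h : HasFiniteEntropy μ fun ω => ((X ω, Y ω), A ω, Z ω))
    (hCI : entropy μ (fun ω => ((X ω, Y ω), A ω, Z ω)) + entropy μ (fun ω => (X ω, Y ω))
      = entropy μ (fun ω => ((X ω, Y ω), A ω)) + entropy μ (fun ω => ((X ω, Y ω), Z ω))) :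
    markovDefect μ X Y (fun ω => (Z ω, A ω)) ≤ markovDefect μ X Y Z + markovDefect μ X Y A := by
  have mJ : Measurable fun ω => ((X ω, Y ω), A ω, Z ω) := by fun_prop
  -- `H(Z,A|Y) ≤ H(Z|Y) + H(A|Y)`, and likewise given `X`, while `hCI` makes `H(Z,A|X,Y)` split
  -- exactly.
  have h1 := entropy_submodular (μ := μ) (J := fun ω => ((Z ω, A ω), Y ω)) (M := Y)
    (F := fun ω => (Z ω, Y ω)) (G := fun ω => (A ω, Y ω))
    (h.of_determines mJ (by fun_prop) fun ω ω' h => by simp_all)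
    (by fun_prop) (by fun_prop) (by fun_prop) hY
    (fun ω ω' => by simp; tauto) (fun ω ω' h => by simp_all) (fun ω ω' h => by simp_all)
  have h2 := entropy_submodular (μ := μ) (J := fun ω => ((Z ω, A ω), X ω)) (M := X)
    (F := fun ω => (Z ω, X ω)) (G := fun ω => (A ω, X ω))
    (h.of_determines mJ (by fun_prop) fun ω ω' h => by simp_all)
    (by fun_prop) (by fun_prop) (by fun_prop) hX
    (fun ω ω' => by simp; tauto) (fun ω ω' h => by simp_all) (fun ω ω' h => by simp_all)
  have e1 := entropy_congr (μ := μ) (F := fun ω => ((Z ω, A ω), X ω, Y ω))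
    (M := fun ω => ((X ω, Y ω), A ω, Z ω)) (by fun_prop) (by fun_prop)
    (fun ω ω' => by simp; tauto)
  have e2 := entropy_congr (μ := μ) (F := fun ω => ((Z ω, A ω), Y ω, X ω))
    (M := fun ω => ((X ω, Y ω), A ω, Z ω)) (by fun_prop) (by fun_prop)
    (fun ω ω' => by simp; tauto)
  have e3 := entropy_congr (μ := μ) (F := fun ω => (Z ω, X ω, Y ω))
    (M := fun ω => ((X ω, Y ω), Z ω)) (by fun_prop) (by fun_prop) (fun ω ω' => by simp; tauto)
  have e4 := entropy_congr (μ := μ) (F := fun ω => (Z ω, Y ω, X ω))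
    (M := fun ω => ((X ω, Y ω), Z ω)) (by fun_prop) (by fun_prop) (fun ω ω' => by simp; tauto)
  have e5 := entropy_congr (μ := μ) (F := fun ω => (A ω, X ω, Y ω))
    (M := fun ω => ((X ω, Y ω), A ω)) (by fun_prop) (by fun_prop) (fun ω ω' => by simp; tauto)
  have e6 := entropy_congr (μ := μ) (F := fun ω => (A ω, Y ω, X ω))
    (M := fun ω => ((X ω, Y ω), A ω)) (by fun_prop) (by fun_prop) (fun ω ω' => by simp; tauto)
  have e7 := entropy_congr (μ := μ) (F := fun ω => (Y ω, X ω)) (M := fun ω => (X ω, Y ω))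
    (by fun_prop) (by fun_prop) (fun ω ω' => by simp; tauto)
  simp only [markovDefect, condMutualInfo, condEntropy]
  linarith

/-- Passing to the conditional Ingleton defect given `Z`, where `Z` is conditionally independent
of `(A, B)` given `(X, Y)`. -/
lemma ingletonDefect_le_cond {X : Ω → S} {Y : Ω → T} {A : Ω → U} {B : Ω → V} {Z : Ω → R}
    (hX : Measurable X) (hY : Measurable Y) (hA : Measurable A) (hB : Measurable B)
    (hZ : Measurable Z) (h : HasFiniteEntropy μ fun ω => ((X ω, Y ω), (A ω, B ω), Z ω))
    (hAB : entropy μ (fun ω => ((X ω, Y ω), (A ω, B ω), Z ω)) + entropy μ (fun ω => (X ω, Y ω))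
      = entropy μ (fun ω => ((X ω, Y ω), (A ω, B ω))) + entropy μ (fun ω => ((X ω, Y ω), Z ω)))
    (hCA : entropy μ (fun ω => ((X ω, Y ω), A ω, Z ω)) + entropy μ (fun ω => (X ω, Y ω))
      = entropy μ (fun ω => ((X ω, Y ω), A ω)) + entropy μ (fun ω => ((X ω, Y ω), Z ω)))
    (hCB : entropy μ (fun ω => ((X ω, Y ω), B ω, Z ω)) + entropy μ (fun ω => (X ω, Y ω))
      = entropy μ (fun ω => ((X ω, Y ω), B ω)) + entropy μ (fun ω => ((X ω, Y ω), Z ω))) :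
    ingletonDefect μ X Y A B ≤ condMutualInfo μ X Y Z - condMutualInfo μ X Y (fun ω => (Z ω, A ω))
      - condMutualInfo μ X Y (fun ω => (Z ω, B ω)) + markovDefect μ X Y Z := by
  have mJ : Measurable fun ω => ((X ω, Y ω), (A ω, B ω), Z ω) := by fun_prop
  -- Expanding `D` minus its version conditioned on `Z`, using conditional independence, leaves
  -- `H(Z|XA) + H(Z|YA) + H(Z|XB) + H(Z|YB) - H(Z|X) - H(Z|Y) - H(Z|XY) - H(Z|AB)`. Dropping `A` and
  -- `B` from the four positive terms (`h1` to `h4`) bounds this by `H(Z|X) + H(Z|Y) - H(Z|XY) -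
  -- H(Z|AB)`.
  have h1 := entropy_submodular (μ := μ) (J := fun ω => (Y ω, Z ω, A ω)) (M := Y)
    (F := fun ω => (Y ω, Z ω)) (G := fun ω => (Y ω, A ω))
    (h.of_determines mJ (by fun_prop) fun ω ω' h => by simp_all)
    (by fun_prop) (by fun_prop) (by fun_prop) hY
    (fun ω ω' => by simp; tauto) (fun ω ω' h => by simp_all) (fun ω ω' h => by simp_all)
  have h2 := entropy_submodular (μ := μ) (J := fun ω => (X ω, Z ω, A ω)) (M := X)
    (F := fun ω => (X ω, Z ω)) (G := fun ω => (X ω, A ω))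
    (h.of_determines mJ (by fun_prop) fun ω ω' h => by simp_all)
    (by fun_prop) (by fun_prop) (by fun_prop) hX
    (fun ω ω' => by simp; tauto) (fun ω ω' h => by simp_all) (fun ω ω' h => by simp_all)
  have h3 := entropy_submodular (μ := μ) (J := fun ω => (Y ω, Z ω, B ω)) (M := Y)
    (F := fun ω => (Y ω, Z ω)) (G := fun ω => (Y ω, B ω))
    (h.of_determines mJ (by fun_prop) fun ω ω' h => by simp_all)
    (by fun_prop) (by fun_prop) (by fun_prop) hY
    (fun ω ω' => by simp; tauto) (fun ω ω' h => by simp_all) (fun ω ω' h => by simp_all)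
  have h4 := entropy_submodular (μ := μ) (J := fun ω => (X ω, Z ω, B ω)) (M := X)
    (F := fun ω => (X ω, Z ω)) (G := fun ω => (X ω, B ω))
    (h.of_determines mJ (by fun_prop) fun ω ω' h => by simp_all)
    (by fun_prop) (by fun_prop) (by fun_prop) hX
    (fun ω ω' => by simp; tauto) (fun ω ω' h => by simp_all) (fun ω ω' h => by simp_all)
  -- `I(A:B|Z) ≥ 0`, so this term can be dropped from the conditioned defect.
  have h5 := entropy_submodular (μ := μ) (J := fun ω => ((A ω, B ω), Z ω)) (M := Z)
    (F := fun ω => (Z ω, A ω)) (G := fun ω => (Z ω, B ω))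
    (h.of_determines mJ (by fun_prop) fun ω ω' h => by simp_all)
    (by fun_prop) (by fun_prop) (by fun_prop) hZ
    (fun ω ω' => by simp; tauto) (fun ω ω' h => by simp_all) (fun ω ω' h => by simp_all)
  -- With `hAB` this reads `H(Z|AB) ≥ H(Z|XY)`, which turns the remaining error into exactly the
  -- Markov defect of `Z`.
  have h6 := entropy_submodular (μ := μ) (J := fun ω => ((X ω, Y ω), (A ω, B ω), Z ω))
    (M := fun ω => (A ω, B ω)) (F := fun ω => ((A ω, B ω), Z ω))
    (G := fun ω => ((X ω, Y ω), (A ω, B ω))) h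
    (by fun_prop) (by fun_prop) (by fun_prop) (by fun_prop)
    (fun ω ω' => by simp; tauto) (fun ω ω' h => by simp_all) (fun ω ω' h => by simp_all)
  have e1 := entropy_congr (μ := μ) (F := fun ω => (X ω, Y ω, Z ω, A ω))
    (M := fun ω => ((X ω, Y ω), A ω, Z ω)) (by fun_prop) (by fun_prop)
    (fun ω ω' => by simp; tauto)
  have e2 := entropy_congr (μ := μ) (F := fun ω => (X ω, Y ω, Z ω, B ω))
    (M := fun ω => ((X ω, Y ω), B ω, Z ω)) (by fun_prop) (by fun_prop)
    (fun ω ω' => by simp; tauto)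
  have e3 := entropy_congr (μ := μ) (F := fun ω => (Z ω, X ω, Y ω))
    (M := fun ω => ((X ω, Y ω), Z ω)) (by fun_prop) (by fun_prop) (fun ω ω' => by simp; tauto)
  have e4 := entropy_congr (μ := μ) (F := fun ω => (Z ω, Y ω, X ω))
    (M := fun ω => ((X ω, Y ω), Z ω)) (by fun_prop) (by fun_prop) (fun ω ω' => by simp; tauto)
  have e5 := entropy_congr (μ := μ) (F := fun ω => (X ω, Y ω, Z ω))
    (M := fun ω => ((X ω, Y ω), Z ω)) (by fun_prop) (by fun_prop) (fun ω ω' => by simp; tauto)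
  have e6 := entropy_congr (μ := μ) (F := fun ω => (X ω, Y ω, A ω))
    (M := fun ω => ((X ω, Y ω), A ω)) (by fun_prop) (by fun_prop) (fun ω ω' => by simp; tauto)
  have e7 := entropy_congr (μ := μ) (F := fun ω => (X ω, Y ω, B ω))
    (M := fun ω => ((X ω, Y ω), B ω)) (by fun_prop) (by fun_prop) (fun ω ω' => by simp; tauto)
  have e8 := entropy_congr (μ := μ) (F := fun ω => (Y ω, X ω)) (M := fun ω => (X ω, Y ω))
    (by fun_prop) (by fun_prop) (fun ω ω' => by simp; tauto)
  have e9 := entropy_congr (μ := μ) (F := fun ω => (Z ω, X ω)) (M := fun ω => (X ω, Z ω))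
    (by fun_prop) (by fun_prop) (fun ω ω' => by simp; tauto)
  have e10 := entropy_congr (μ := μ) (F := fun ω => (Z ω, Y ω)) (M := fun ω => (Y ω, Z ω))
    (by fun_prop) (by fun_prop) (fun ω ω' => by simp; tauto)
  simp only [ingletonDefect, markovDefect, mutualInfo, condMutualInfo, condEntropy]
  linarith

end Inequalities

open ProbabilityTheory

/-! ### Invariance of information quantities under equality in law and under recoding. -/

section Laws

variable {Ω Ω' R S T U : Type*} [MeasurableSpace Ω] {μ : Measure Ω}
  [MeasurableSpace Ω'] {ν : Measure Ω'}
  [Countable R] [MeasurableSpace R] [MeasurableSingletonClass R]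
  [Countable S] [MeasurableSpace S] [MeasurableSingletonClass S]
  [Countable T] [MeasurableSpace T] [MeasurableSingletonClass T]
  [Countable U] [MeasurableSpace U] [MeasurableSingletonClass U]

omit [Countable T] in
lemma measureReal_comp_preimage_eq_of_map_eq {F : Ω → S} {F' : Ω' → S} (hF : Measurable F)
    (hF' : Measurable F') (h : μ.map F = ν.map F') (f : S → T) (t : T) :
    μ.real ((fun ω => f (F ω)) ⁻¹' {t}) = ν.real ((fun ω => f (F' ω)) ⁻¹' {t}) := by
  have hf : Measurable f := measurable_of_countable f
  have e1 := map_measureReal_apply (μ := μ) hF (hf (measurableSet_singleton t))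
  have e2 := map_measureReal_apply (μ := ν) hF' (hf (measurableSet_singleton t))
  rw [h] at e1
  exact e1.symm.trans e2

omit [Countable T] in
lemma entropy_comp_eq_of_map_eq {F : Ω → S} {F' : Ω' → S} (hF : Measurable F)
    (hF' : Measurable F') (h : μ.map F = ν.map F') (f : S → T) :
    entropy μ (fun ω => f (F ω)) = entropy ν (fun ω => f (F' ω)) :=
  tsum_congr fun t => by rw [measureReal_comp_preimage_eq_of_map_eq hF hF' h f t]

omit [Countable T] in
lemma HasFiniteEntropy.comp_of_map_eq {F : Ω → S} {F' : Ω' → S} (hF : Measurable F)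
    (hF' : Measurable F') (h : μ.map F = ν.map F') (f : S → T)
    (hfin : HasFiniteEntropy μ (fun ω => f (F ω))) : HasFiniteEntropy ν (fun ω => f (F' ω)) := by
  refine hfin.congr fun t => ?_
  rw [measureReal_comp_preimage_eq_of_map_eq hF hF' h f t]

lemma condMutualInfo_eq_of_map_eq {X : Ω → S} {Y : Ω → T} {Z : Ω → U} {X' : Ω' → S} {Y' : Ω' → T}
    {Z' : Ω' → U} (hF : Measurable fun ω => (X ω, Y ω, Z ω))
    (hF' : Measurable fun ω => (X' ω, Y' ω, Z' ω))
    (h : μ.map (fun ω => (X ω, Y ω, Z ω)) = ν.map (fun ω => (X' ω, Y' ω, Z' ω))) :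
    condMutualInfo μ X Y Z = condMutualInfo ν X' Y' Z' := by
  have e1 := entropy_comp_eq_of_map_eq hF hF' h fun p => (p.1, p.2.2)
  have e2 := entropy_comp_eq_of_map_eq hF hF' h fun p => p.2.2
  have e3 := entropy_comp_eq_of_map_eq hF hF' h fun p => p
  have e4 := entropy_comp_eq_of_map_eq hF hF' h fun p => p.2
  simp only at e1 e2 e3 e4
  simp only [condMutualInfo, condEntropy, e1, e2, e3, e4]

omit [Countable T] [MeasurableSingletonClass T] in
lemma map_comp_eq_of_map_eq {F : Ω → S} {F' : Ω' → S} (hF : Measurable F)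
    (hF' : Measurable F') (h : μ.map F = ν.map F') (f : S → T) :
    μ.map (fun ω => f (F ω)) = ν.map (fun ω => f (F' ω)) := by
  have hf : Measurable f := measurable_of_countable f
  have e1 := Measure.map_map (μ := μ) hf hF
  have e2 := Measure.map_map (μ := ν) hf hF'
  rw [h] at e1
  exact e1.symm.trans e2

lemma markovDefect_eq_of_map_eq {X : Ω → S} {Y : Ω → T} {Z : Ω → U} {X' : Ω' → S} {Y' : Ω' → T}
    {Z' : Ω' → U} (hF : Measurable fun ω => (X ω, Y ω, Z ω))
    (hF' : Measurable fun ω => (X' ω, Y' ω, Z' ω))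
    (h : μ.map (fun ω => (X ω, Y ω, Z ω)) = ν.map (fun ω => (X' ω, Y' ω, Z' ω))) :
    markovDefect μ X Y Z = markovDefect ν X' Y' Z' := by
  have m1 : Measurable fun p : S × T × U => (p.2.2, p.1, p.2.1) := measurable_of_countable _
  have m2 : Measurable fun p : S × T × U => (p.2.2, p.2.1, p.1) := measurable_of_countable _
  unfold markovDefect
  congr 1
  · exact condMutualInfo_eq_of_map_eq (m1.comp hF) (m1.comp hF')
      (map_comp_eq_of_map_eq hF hF' h fun p => (p.2.2, p.1, p.2.1))
  · exact condMutualInfo_eq_of_map_eq (m2.comp hF) (m2.comp hF')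
      (map_comp_eq_of_map_eq hF hF' h fun p => (p.2.2, p.2.1, p.1))

lemma mutualInfo_eq_of_map_eq {X : Ω → S} {Y : Ω → T} {X' : Ω' → S} {Y' : Ω' → T}
    (hF : Measurable fun ω => (X ω, Y ω)) (hF' : Measurable fun ω => (X' ω, Y' ω))
    (h : μ.map (fun ω => (X ω, Y ω)) = ν.map (fun ω => (X' ω, Y' ω))) :
    mutualInfo μ X Y = mutualInfo ν X' Y' := by
  have e1 := entropy_comp_eq_of_map_eq hF hF' h fun p => p.1
  have e2 := entropy_comp_eq_of_map_eq hF hF' h fun p => p.2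
  have e3 := entropy_comp_eq_of_map_eq hF hF' h fun p => p
  simp only at e1 e2 e3
  simp only [mutualInfo, condEntropy, e1, e2, e3]

lemma condMutualInfo_congr [IsProbabilityMeasure μ] {R' S' T' : Type*}
    [Countable R'] [MeasurableSpace R'] [MeasurableSingletonClass R']
    [Countable S'] [MeasurableSpace S'] [MeasurableSingletonClass S']
    [Countable T'] [MeasurableSpace T'] [MeasurableSingletonClass T']
    {X : Ω → R} {Y : Ω → S} {Z : Ω → T} {X' : Ω → R'} {Y' : Ω → S'} {Z' : Ω → T'}
    (hX : Measurable X) (hY : Measurable Y) (hZ : Measurable Z)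
    (hX' : Measurable X') (hY' : Measurable Y') (hZ' : Measurable Z')
    (eX : ∀ ω ω', X ω = X ω' ↔ X' ω = X' ω') (eY : ∀ ω ω', Y ω = Y ω' ↔ Y' ω = Y' ω')
    (eZ : ∀ ω ω', Z ω = Z ω' ↔ Z' ω = Z' ω') :
    condMutualInfo μ X Y Z = condMutualInfo μ X' Y' Z' := by
  unfold condMutualInfo condEntropy
  rw [entropy_congr (μ := μ) (hX.prodMk hZ) (hX'.prodMk hZ') (by simp [eX, eZ]),
    entropy_congr (μ := μ) hZ hZ' eZ,
    entropy_congr (μ := μ) (hX.prodMk (hY.prodMk hZ)) (hX'.prodMk (hY'.prodMk hZ'))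
      (by simp [eX, eY, eZ]),
    entropy_congr (μ := μ) (hY.prodMk hZ) (hY'.prodMk hZ') (by simp [eY, eZ])]

lemma mutualInfo_congr [IsProbabilityMeasure μ] {R' S' : Type*}
    [Countable R'] [MeasurableSpace R'] [MeasurableSingletonClass R']
    [Countable S'] [MeasurableSpace S'] [MeasurableSingletonClass S']
    {X : Ω → R} {Y : Ω → S} {X' : Ω → R'} {Y' : Ω → S'}
    (hX : Measurable X) (hY : Measurable Y) (hX' : Measurable X') (hY' : Measurable Y')
    (eX : ∀ ω ω', X ω = X ω' ↔ X' ω = X' ω') (eY : ∀ ω ω', Y ω = Y ω' ↔ Y' ω = Y' ω') :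
    mutualInfo μ X Y = mutualInfo μ X' Y' := by
  unfold mutualInfo condEntropy
  rw [entropy_congr (μ := μ) (hX.prodMk hY) (hX'.prodMk hY') (by simp [eX, eY]),
    entropy_congr (μ := μ) hX hX' eX, entropy_congr (μ := μ) hY hY' eY]

end Laws

/-! ### Adjoining conditionally independent variables. -/

section Coupling

variable {Ω S T : Type*} [MeasurableSpace Ω] {μ : Measure Ω} [IsProbabilityMeasure μ]
  [Countable S] [MeasurableSpace S] [MeasurableSingletonClass S]
  [Countable T] [MeasurableSpace T] [MeasurableSingletonClass T]

/-- Adjoin to `(Ω, μ)` a random variable whose conditional law given everything else is `ζ` of the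
value of `E`. -/
noncomputable def adjoin {Ω S : Type*} [MeasurableSpace Ω] [MeasurableSpace S] (μ : Measure Ω)
    {E : Ω → S} (hE : Measurable E) (ζ : Kernel S ℕ) : Measure (Ω × ℕ) :=
  μ ⊗ₘ (ζ.comap E hE)

instance {E : Ω → S} (hE : Measurable E) (ζ : Kernel S ℕ) [IsMarkovKernel ζ] :
    IsProbabilityMeasure (adjoin μ hE ζ) := by
  unfold adjoin
  infer_instance

omit [Countable S] [MeasurableSingletonClass S] [Countable T] [MeasurableSingletonClass T] in
lemma map_fst_adjoin {E : Ω → S} (hE : Measurable E) (ζ : Kernel S ℕ) [IsMarkovKernel ζ]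
    {F : Ω → T} (hF : Measurable F) : (adjoin μ hE ζ).map (fun p => F p.1) = μ.map F := by
  have h : (adjoin μ hE ζ).map Prod.fst = μ := Measure.fst_compProd _ _
  conv_rhs => rw [← h]
  exact (Measure.map_map hF measurable_fst).symm

omit [Countable S] [MeasurableSingletonClass S] in
lemma adjoin_real_prod {E : Ω → S} (hE : Measurable E) (ζ : Kernel S ℕ) [IsMarkovKernel ζ]
    {s : Set Ω} (hs : MeasurableSet s) (e : S) (hse : s ⊆ E ⁻¹' {e}) (z : ℕ) :
    (adjoin μ hE ζ).real (s ×ˢ {z}) = μ.real s * (ζ e).real {z} := by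
  have : (adjoin μ hE ζ) (s ×ˢ {z}) = ζ e {z} * μ s := by
    rw [adjoin, Measure.compProd_apply_prod hs (measurableSet_singleton z), ← setLIntegral_const]
    refine setLIntegral_congr_fun hs fun ω hω => ?_
    have : E ω = e := hse hω
    simp [Kernel.comap_apply, this]
  rw [measureReal_def, this, ENNReal.toReal_mul, mul_comm]
  rfl

omit [Countable S] in
lemma adjoin_real_pair {E : Ω → S} (hE : Measurable E) (ζ : Kernel S ℕ) [IsMarkovKernel ζ]
    (e : S) (z : ℕ) :
    (adjoin μ hE ζ).real ((fun p => (E p.1, p.2)) ⁻¹' {(e, z)})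
      = μ.real (E ⁻¹' {e}) * (ζ e).real {z} := by
  rw [← adjoin_real_prod hE ζ (hE (measurableSet_singleton e)) e subset_rfl z]
  congr 1
  ext p
  simp

omit [Countable S] [Countable T] in
lemma adjoin_real_triple {E : Ω → S} (hE : Measurable E) (ζ : Kernel S ℕ) [IsMarkovKernel ζ]
    {G : Ω → T} (hG : Measurable G) (e : S) (g : T) (z : ℕ) :
    (adjoin μ hE ζ).real ((fun p => (E p.1, G p.1, p.2)) ⁻¹' {(e, g, z)})
      = μ.real ((fun ω => (E ω, G ω)) ⁻¹' {(e, g)}) * (ζ e).real {z} := by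
  rw [← adjoin_real_prod hE ζ ((hE.prodMk hG) (measurableSet_singleton (e, g))) e
    (fun ω h => by simp_all) z]
  congr 1
  ext p
  simp [and_assoc]

lemma adjoin_entropy_add {E : Ω → S} (hE : Measurable E) (ζ : Kernel S ℕ) [IsMarkovKernel ζ]
    {G : Ω → T} (hG : Measurable G) (h1 : HasFiniteEntropy μ fun ω => (E ω, G ω))
    (h2 : HasFiniteEntropy (adjoin μ hE ζ) fun p => (E p.1, p.2)) :
    HasFiniteEntropy (adjoin μ hE ζ) (fun p => (E p.1, G p.1, p.2)) ∧
      entropy (adjoin μ hE ζ) (fun p => (E p.1, G p.1, p.2))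
          + entropy (adjoin μ hE ζ) (fun p => E p.1)
        = entropy (adjoin μ hE ζ) (fun p => (E p.1, G p.1))
          + entropy (adjoin μ hE ζ) (fun p => (E p.1, p.2)) := by
  have hfst : ∀ e, (adjoin μ hE ζ).real ((fun p => E p.1) ⁻¹' {e}) = μ.real (E ⁻¹' {e}) := fun e =>
    measureReal_comp_preimage_eq_of_map_eq (by fun_prop) hE (map_fst_adjoin hE ζ hE) id e
  have hfst' : ∀ p, (adjoin μ hE ζ).real ((fun p => (E p.1, G p.1)) ⁻¹' {p})
      = μ.real ((fun ω => (E ω, G ω)) ⁻¹' {p}) := fun p =>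
    measureReal_comp_preimage_eq_of_map_eq (by fun_prop) (by fun_prop)
      (map_fst_adjoin hE ζ (hE.prodMk hG)) id p
  refine entropy_add_entropy_eq_of_condLaw (by fun_prop) (by fun_prop) measurable_snd
    (fun e z => (ζ e).real {z}) (fun e z => ?_) (fun e g z => ?_) ?_ h2
  · rw [hfst, adjoin_real_pair]
  · rw [hfst', adjoin_real_triple hE ζ hG]
  · exact HasFiniteEntropy.comp_of_map_eq (hE.prodMk hG) (by fun_prop)
      (map_fst_adjoin hE ζ (hE.prodMk hG)).symm id h1

/-- The conditional law of a pair of conditionally independent variables, encoded in `ℕ`. -/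
noncomputable def pairKernel {S : Type*} [MeasurableSpace S] (ζ κ : Kernel S ℕ) : Kernel S ℕ :=
  (ζ ×ₖ κ).map fun p => Nat.pair p.1 p.2

instance (ζ κ : Kernel S ℕ) [IsMarkovKernel ζ] [IsMarkovKernel κ] :
    IsMarkovKernel (pairKernel ζ κ) :=
  Kernel.IsMarkovKernel.map _ (measurable_of_countable _)

omit [Countable S] [MeasurableSingletonClass S] in
lemma pairKernel_real_singleton (ζ κ : Kernel S ℕ) [IsMarkovKernel ζ] [IsMarkovKernel κ] (e : S)
    (n : ℕ) : (pairKernel ζ κ e).real {n}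
      = (ζ e).real {n.unpair.1} * (κ e).real {n.unpair.2} := by
  have : (fun p : ℕ × ℕ => Nat.pair p.1 p.2) ⁻¹' {n} = {n.unpair.1} ×ˢ {n.unpair.2} := by
    ext ⟨a, b⟩
    simp only [Set.mem_preimage, Set.mem_singleton_iff, Set.mem_prod]
    constructor
    · rintro rfl
      simp
    · rintro ⟨rfl, rfl⟩
      simp
  rw [pairKernel, measureReal_def, Kernel.map_apply' _ (measurable_of_countable _) _
    (measurableSet_singleton n), this, Kernel.prod_apply, Measure.prod_prod, ENNReal.toReal_mul]
  rfl

/-- Given `E`, the adjoined variable and `A` are independent with laws `ζ` and `κ`, so their pair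
has conditional law `pairKernel ζ κ`. Encoding it in `ℕ` makes it adjoinable in turn, so the
doubling can iterate over kernels of a fixed type. -/
lemma map_pair_adjoin {E : Ω → S} (hE : Measurable E) (ζ κ : Kernel S ℕ) [IsMarkovKernel ζ]
    [IsMarkovKernel κ] {A : Ω → ℕ} (hA : Measurable A)
    (hκ : ∀ e a, μ.real ((fun ω => (E ω, A ω)) ⁻¹' {(e, a)})
      = μ.real (E ⁻¹' {e}) * (κ e).real {a}) :
    (adjoin μ hE ζ).map (fun p => (E p.1, Nat.pair p.2 (A p.1)))
      = (adjoin μ hE (pairKernel ζ κ)).map (fun p => (E p.1, p.2)) := by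
  have hm : Measurable fun p : Ω × ℕ => (E p.1, Nat.pair p.2 (A p.1)) :=
    (hE.comp measurable_fst).prodMk ((measurable_of_countable fun q : ℕ × ℕ =>
      Nat.pair q.1 q.2).comp (measurable_snd.prodMk (hA.comp measurable_fst)))
  refine Measure.ext_of_singleton fun ⟨e, n⟩ => ?_
  rw [Measure.map_apply hm (measurableSet_singleton _),
    Measure.map_apply (by fun_prop) (measurableSet_singleton _),
    ← measureReal_eq_measureReal_iff, adjoin_real_pair, pairKernel_real_singleton]
  have : (fun p : Ω × ℕ => (E p.1, Nat.pair p.2 (A p.1))) ⁻¹' {(e, n)}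
      = (fun p : Ω × ℕ => (E p.1, A p.1, p.2)) ⁻¹' {(e, n.unpair.2, n.unpair.1)} := by
    ext p
    simp only [Set.mem_preimage, Set.mem_singleton_iff, Prod.mk.injEq]
    refine and_congr_right fun _ => ?_
    constructor
    · rintro rfl
      simp
    · rintro ⟨h1, h2⟩
      rw [h1, h2, Nat.pair_unpair]
  rw [this, adjoin_real_triple hE ζ hA, hκ]
  ring

omit [Countable S] in
lemma exists_condLaw {E : Ω → S} (hE : Measurable E) {A : Ω → ℕ} (hA : Measurable A) :
    ∃ κ : Kernel S ℕ, IsMarkovKernel κ ∧ ∀ e a, μ.real ((fun ω => (E ω, A ω)) ⁻¹' {(e, a)})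
      = μ.real (E ⁻¹' {e}) * (κ e).real {a} := by
  refine ⟨condDistrib A E μ, inferInstance, fun e a => ?_⟩
  rcases eq_or_ne (μ (E ⁻¹' {e})) 0 with h0 | h0
  · have hle : μ ((fun ω => (E ω, A ω)) ⁻¹' {(e, a)}) ≤ μ (E ⁻¹' {e}) :=
      measure_mono fun ω h => by simp_all
    simp [measureReal_def, h0, le_antisymm (h0 ▸ hle) zero_le]
  · have hmap : μ.map E {e} = μ (E ⁻¹' {e}) := Measure.map_apply hE (measurableSet_singleton e)
    rw [measureReal_def, measureReal_def, measureReal_def,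
      condDistrib_apply_of_ne_zero hA e (hmap ▸ h0), hmap, ← ENNReal.toReal_mul, ← mul_assoc,
      ENNReal.mul_inv_cancel h0 (measure_ne_top _ _), one_mul, Set.singleton_prod_singleton,
      Measure.map_apply (hE.prodMk hA) (measurableSet_singleton _)]

end Coupling

/-! ### The doubling argument. -/

section Doubling

variable {Ω S T : Type*} [MeasurableSpace Ω] {μ : Measure Ω} [IsProbabilityMeasure μ]
  [Countable S] [MeasurableSpace S] [MeasurableSingletonClass S]
  [Countable T] [MeasurableSpace T] [MeasurableSingletonClass T]

/-- Passes from a node `Z` of the tree to its child (Z, A). The child is adjoined to the original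
space afresh, which restores its conditional independence from the original variables; the
quantities compared depend only on its joint law with (X, Y). -/
lemma adjoin_pairKernel_of_condLaw {X : Ω → S} {Y : Ω → T} {A : Ω → ℕ} (hX : Measurable X)
    (hY : Measurable Y) (hA : Measurable A)
    (h : HasFiniteEntropy μ fun ω => ((X ω, Y ω), A ω))
    (ζ κ : Kernel (S × T) ℕ) [IsMarkovKernel ζ] [IsMarkovKernel κ]
    (hκ : ∀ e a, μ.real ((fun ω => ((X ω, Y ω), A ω)) ⁻¹' {(e, a)})
      = μ.real ((fun ω => (X ω, Y ω)) ⁻¹' {e}) * (κ e).real {a})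
    (hζ : HasFiniteEntropy (adjoin μ (hX.prodMk hY) ζ) fun p => ((X p.1, Y p.1), p.2)) :
    HasFiniteEntropy (adjoin μ (hX.prodMk hY) (pairKernel ζ κ))
        (fun p => ((X p.1, Y p.1), p.2)) ∧
      condMutualInfo (adjoin μ (hX.prodMk hY) (pairKernel ζ κ)) (fun p => X p.1) (fun p => Y p.1)
          Prod.snd
        = condMutualInfo (adjoin μ (hX.prodMk hY) ζ) (fun p => X p.1) (fun p => Y p.1)
          (fun p => (p.2, A p.1)) ∧
      markovDefect (adjoin μ (hX.prodMk hY) (pairKernel ζ κ)) (fun p => X p.1) (fun p => Y p.1)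
          Prod.snd
        ≤ markovDefect (adjoin μ (hX.prodMk hY) ζ) (fun p => X p.1) (fun p => Y p.1) Prod.snd
          + markovDefect μ X Y A := by
  have hE := hX.prodMk hY
  have mpair : Measurable fun p : Ω × ℕ => Nat.pair p.2 (A p.1) :=
    (measurable_of_countable fun q : ℕ × ℕ => Nat.pair q.1 q.2).comp
      (measurable_snd.prodMk (hA.comp measurable_fst))
  obtain ⟨hfin, hCI⟩ := adjoin_entropy_add hE ζ hA h hζ
  have hlaw := map_pair_adjoin hE ζ κ hA hκ
  have mF : Measurable fun p : Ω × ℕ => ((X p.1, Y p.1), Nat.pair p.2 (A p.1)) := by fun_prop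
  have mF' : Measurable fun p : Ω × ℕ => ((X p.1, Y p.1), p.2) := by fun_prop
  have hlaw3 := map_comp_eq_of_map_eq mF mF' hlaw fun q => (q.1.1, q.1.2, q.2)
  have hker : ∀ p p' : Ω × ℕ, Nat.pair p.2 (A p.1) = Nat.pair p'.2 (A p'.1)
      ↔ (p.2, A p.1) = (p'.2, A p'.1) := by simp [Nat.pair_eq_pair]
  have mX : Measurable fun p : Ω × ℕ => X p.1 := by fun_prop
  have mY : Measurable fun p : Ω × ℕ => Y p.1 := by fun_prop
  have mA : Measurable fun p : Ω × ℕ => A p.1 := by fun_prop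
  have mZA : Measurable fun p : Ω × ℕ => (p.2, A p.1) := by fun_prop
  refine ⟨?_, ?_, ?_⟩
  · refine HasFiniteEntropy.comp_of_map_eq mF mF' hlaw id (hfin.of_determines
      (by fun_prop) mF fun p p' h => ?_)
    simp_all
  · rw [← condMutualInfo_eq_of_map_eq (by fun_prop) (by fun_prop) hlaw3]
    exact condMutualInfo_congr mX mY mpair mX mY mZA (fun _ _ => Iff.rfl) (fun _ _ => Iff.rfl) hker
  · rw [← markovDefect_eq_of_map_eq (by fun_prop) (by fun_prop) hlaw3]
    have e1 : markovDefect (adjoin μ hE ζ) (fun p => X p.1) (fun p => Y p.1)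
        (fun p => Nat.pair p.2 (A p.1)) = markovDefect (adjoin μ hE ζ) (fun p => X p.1)
          (fun p => Y p.1) (fun p => (p.2, A p.1)) := by
      unfold markovDefect
      rw [condMutualInfo_congr mpair mX mY mZA mX mY hker (fun _ _ => Iff.rfl) (fun _ _ => Iff.rfl),
        condMutualInfo_congr mpair mY mX mZA mY mX hker (fun _ _ => Iff.rfl) (fun _ _ => Iff.rfl)]
    have e2 : markovDefect (adjoin μ hE ζ) (fun p => X p.1) (fun p => Y p.1) (fun p => A p.1)
        = markovDefect μ X Y A :=
      markovDefect_eq_of_map_eq (by fun_prop) (by fun_prop)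
        (map_fst_adjoin hE ζ (hX.prodMk (hY.prodMk hA)))
    rw [e1, ← e2]
    exact markovDefect_pair_le mX mY mA measurable_snd hfin hCI

lemma ingletonDefect_adjoin {X : Ω → S} {Y : Ω → T} {A B : Ω → ℕ} (hX : Measurable X)
    (hY : Measurable Y) (hA : Measurable A) (hB : Measurable B)
    (ζ : Kernel (S × T) ℕ) [IsMarkovKernel ζ] :
    ingletonDefect (adjoin μ (hX.prodMk hY) ζ) (fun p => X p.1) (fun p => Y p.1) (fun p => A p.1)
      (fun p => B p.1) = ingletonDefect μ X Y A B := by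
  have hE := hX.prodMk hY
  have h1 : mutualInfo (adjoin μ hE ζ) (fun p => X p.1) (fun p => Y p.1) = mutualInfo μ X Y :=
    mutualInfo_eq_of_map_eq (by fun_prop) hE (map_fst_adjoin hE ζ hE)
  have h2 : mutualInfo (adjoin μ hE ζ) (fun p => A p.1) (fun p => B p.1) = mutualInfo μ A B :=
    mutualInfo_eq_of_map_eq (by fun_prop) (by fun_prop) (map_fst_adjoin hE ζ (hA.prodMk hB))
  have h3 : condMutualInfo (adjoin μ hE ζ) (fun p => X p.1) (fun p => Y p.1) (fun p => A p.1)
      = condMutualInfo μ X Y A :=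
    condMutualInfo_eq_of_map_eq (by fun_prop) (by fun_prop)
      (map_fst_adjoin hE ζ (hX.prodMk (hY.prodMk hA)))
  have h4 : condMutualInfo (adjoin μ hE ζ) (fun p => X p.1) (fun p => Y p.1) (fun p => B p.1)
      = condMutualInfo μ X Y B :=
    condMutualInfo_eq_of_map_eq (by fun_prop) (by fun_prop)
      (map_fst_adjoin hE ζ (hX.prodMk (hY.prodMk hB)))
  unfold ingletonDefect
  rw [h1, h2, h3, h4]

/-- Conditioning on `n` successive copies, each of `A` or of `B`, in all `2 ^ n` possible ways. -/
lemma ingletonDefect_doubling {X : Ω → S} {Y : Ω → T} {A B : Ω → ℕ} (hX : Measurable X)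
    (hY : Measurable Y) (hA : Measurable A) (hB : Measurable B)
    (h : HasFiniteEntropy μ fun ω => ((X ω, Y ω), (A ω, B ω))) {e : ℝ} (he : 0 ≤ e)
    (heA : markovDefect μ X Y A ≤ e) (heB : markovDefect μ X Y B ≤ e) (n : ℕ) :
    ∀ ζ : Kernel (S × T) ℕ, IsMarkovKernel ζ →
      HasFiniteEntropy (adjoin μ (hX.prodMk hY) ζ) (fun p => ((X p.1, Y p.1), p.2)) →
      (2 ^ n - 1) * ingletonDefect μ X Y A B
        ≤ condMutualInfo (adjoin μ (hX.prodMk hY) ζ) (fun p => X p.1) (fun p => Y p.1) Prod.snd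
          + (2 ^ n - 1) * markovDefect (adjoin μ (hX.prodMk hY) ζ) (fun p => X p.1)
              (fun p => Y p.1) Prod.snd
          + n * 2 ^ n * e := by
  have hE := hX.prodMk hY
  have mF : Measurable fun ω => ((X ω, Y ω), (A ω, B ω)) := by fun_prop
  have fA : HasFiniteEntropy μ fun ω => ((X ω, Y ω), A ω) :=
    h.of_determines mF (by fun_prop) fun ω ω' h => by simp_all
  have fB : HasFiniteEntropy μ fun ω => ((X ω, Y ω), B ω) :=
    h.of_determines mF (by fun_prop) fun ω ω' h => by simp_all
  obtain ⟨κA, _, hκA⟩ := exists_condLaw (μ := μ) hE hA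
  obtain ⟨κB, _, hκB⟩ := exists_condLaw (μ := μ) hE hB
  -- The kernel stays universally quantified: the inductive hypothesis is needed at both children of
  -- `ζ`.
  induction n with
  | zero =>
    intro ζ _ hζ
    have := condMutualInfo_nonneg (μ := adjoin μ hE ζ) (X := fun p => X p.1) (Y := fun p => Y p.1)
      (Z := Prod.snd) (by fun_prop) (by fun_prop) (by fun_prop)
      (hζ.of_determines (by fun_prop) (by fun_prop) fun p p' h => by simp_all)
    simpa using this
  | succ n ih =>
    intro ζ _ hζ
    obtain ⟨f1, i1, d1⟩ := adjoin_pairKernel_of_condLaw hX hY hA fA ζ κA hκA hζ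
    obtain ⟨f2, i2, d2⟩ := adjoin_pairKernel_of_condLaw hX hY hB fB ζ κB hκB hζ
    have ih1 := ih _ inferInstance f1
    have ih2 := ih _ inferInstance f2
    obtain ⟨hfin, hAB⟩ := adjoin_entropy_add hE ζ (hA.prodMk hB) h hζ
    have step := ingletonDefect_le_cond (μ := adjoin μ hE ζ) (X := fun p => X p.1)
      (Y := fun p => Y p.1) (A := fun p => A p.1) (B := fun p => B p.1) (Z := Prod.snd)
      (by fun_prop) (by fun_prop) (by fun_prop) (by fun_prop) measurable_snd hfin hAB
      (adjoin_entropy_add hE ζ hA fA hζ).2 (adjoin_entropy_add hE ζ hB fB hζ).2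
    rw [ingletonDefect_adjoin hX hY hA hB ζ] at step
    rw [i1] at ih1
    rw [i2] at ih2
    have ht : (0 : ℝ) ≤ 2 ^ n - 1 := by
      have := one_le_pow₀ (M₀ := ℝ) one_le_two (n := n)
      linarith
    have m1 := mul_le_mul_of_nonneg_left (d1.trans (add_le_add_right heA _)) ht
    have m2 := mul_le_mul_of_nonneg_left (d2.trans (add_le_add_right heB _)) ht
    rw [pow_succ]
    push_cast
    -- The children contribute `2 (2^n - 1) e + 2 n 2^n e`, which is at most `(n + 1) 2^(n+1) e`
    -- because `e ≥ 0`.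
    linarith

/-- Any number of doublings, started from a constant. -/
lemma ingletonDefect_le_of_markovDefect_le {X : Ω → S} {Y : Ω → T} {A B : Ω → ℕ}
    (hX : Measurable X)
    (hY : Measurable Y) (hA : Measurable A) (hB : Measurable B)
    (h : HasFiniteEntropy μ fun ω => ((X ω, Y ω), (A ω, B ω))) {e : ℝ} (he : 0 ≤ e)
    (heA : markovDefect μ X Y A ≤ e) (heB : markovDefect μ X Y B ≤ e) (n : ℕ) :
    (2 ^ n - 1) * ingletonDefect μ X Y A B ≤ mutualInfo μ X Y + n * 2 ^ n * e := by
  have hE := hX.prodMk hY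
  -- The root of the tree is a constant: its conditional mutual information is `I(X:Y)` and its
  -- Markov defect is 0.
  set ζ : Kernel (S × T) ℕ := Kernel.const _ (Measure.dirac 0)
  have mF : Measurable fun ω => ((X ω, Y ω), (0 : ℕ)) := by fun_prop
  have mF' : Measurable fun p : Ω × ℕ => ((X p.1, Y p.1), p.2) := by fun_prop
  have hlaw : μ.map (fun ω => ((X ω, Y ω), (0 : ℕ)))
      = (adjoin μ hE ζ).map (fun p => ((X p.1, Y p.1), p.2)) := by
    refine Measure.ext_of_singleton fun ⟨q, n⟩ => ?_
    rw [Measure.map_apply mF (measurableSet_singleton _),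
      Measure.map_apply mF' (measurableSet_singleton _),
      ← measureReal_eq_measureReal_iff, adjoin_real_pair hE]
    rcases eq_or_ne n 0 with rfl | hn
    · simp only [ζ, Kernel.const_apply]
      simp [Set.preimage, measureReal_def]
    · have : (fun ω => ((X ω, Y ω), (0 : ℕ))) ⁻¹' {(q, n)} = ∅ := by
        ext ω
        simp [hn.symm]
      simp [this, ζ, measureReal_def, hn.symm]
  have hlaw3 := map_comp_eq_of_map_eq mF mF' hlaw fun q => (q.1.1, q.1.2, q.2)
  have fin0 : HasFiniteEntropy μ fun ω => ((X ω, Y ω), (0 : ℕ)) :=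
    h.of_determines (by fun_prop) mF fun ω ω' h => by simp_all
  have key := ingletonDefect_doubling hX hY hA hB h he heA heB n ζ inferInstance
    (HasFiniteEntropy.comp_of_map_eq mF mF' hlaw id fin0)
  rw [← condMutualInfo_eq_of_map_eq (by fun_prop) (by fun_prop) hlaw3,
    ← markovDefect_eq_of_map_eq (by fun_prop) (by fun_prop) hlaw3] at key
  have c0 : entropy μ (fun _ => (0 : ℕ)) = 0 := entropy_const 0
  have cX : entropy μ (fun ω => (X ω, (0 : ℕ))) = entropy μ X :=
    entropy_congr (by fun_prop) hX (by simp)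
  have cY : entropy μ (fun ω => (Y ω, (0 : ℕ))) = entropy μ Y :=
    entropy_congr (by fun_prop) hY (by simp)
  have cX' : entropy μ (fun ω => ((0 : ℕ), X ω)) = entropy μ X :=
    entropy_congr (by fun_prop) hX (by simp)
  have cY' : entropy μ (fun ω => ((0 : ℕ), Y ω)) = entropy μ Y :=
    entropy_congr (by fun_prop) hY (by simp)
  have cXY : entropy μ (fun ω => (X ω, Y ω, (0 : ℕ))) = entropy μ (fun ω => (X ω, Y ω)) :=
    entropy_congr (by fun_prop) hE (by simp)
  have cXY' : entropy μ (fun ω => ((0 : ℕ), X ω, Y ω)) = entropy μ (fun ω => (X ω, Y ω)) :=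
    entropy_congr (by fun_prop) hE (by simp)
  have cYX' : entropy μ (fun ω => ((0 : ℕ), Y ω, X ω)) = entropy μ (fun ω => (Y ω, X ω)) :=
    entropy_congr (by fun_prop) (by fun_prop) (by simp)
  have k1 : condMutualInfo μ X Y (fun _ => (0 : ℕ)) = mutualInfo μ X Y := by
    simp only [condMutualInfo, mutualInfo, condEntropy, c0, cX, cY, cXY]
    ring
  have k2 : markovDefect μ X Y (fun _ => (0 : ℕ)) = 0 := by
    simp only [markovDefect, condMutualInfo, condEntropy, cX', cY', cXY', cYX']
    ring
  simpa [k1, k2] using key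

end Doubling
-- Choice of the depth, and the conclusion.
/-- Optimizing the number `n` of doublings, `2 ^ n ≈ 1 / ε`. -/
lemma le_mul_log_inv_of_doubling {D I ε : ℝ} (hI : 0 ≤ I) (hε0 : 0 ≤ ε) (hε : ε ≤ 1 / 2)
    (h : ∀ n : ℕ, (2 ^ n - 1) * D ≤ I + n * 2 ^ n * (2 * ε * I)) :
    D ≤ 10 / Real.log 2 * (ε * Real.log ε⁻¹) * I := by
  have hlog : 0 < Real.log 2 := Real.log_pos one_lt_two
  -- For `n ≥ 1` one has `2^n - 1 ≥ 2^n / 2`, so dividing by `2^n / 2` costs a factor 2 when `D >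
  -- 0`.
  have h1 : ∀ n : ℕ, 1 ≤ n → D ≤ (2 / 2 ^ n + 4 * n * ε) * I := by
    intro n hn
    have h2 : (2 : ℝ) ≤ 2 ^ n := by
      simpa using pow_le_pow_right₀ (one_le_two (α := ℝ)) hn
    have hR : 0 ≤ (2 / 2 ^ n + 4 * n * ε) * I := by positivity
    rcases le_or_gt D 0 with hD | hD
    · exact hD.trans hR
    have h3 : 2 ^ n / 2 * D ≤ I + n * 2 ^ n * (2 * ε * I) :=
      (mul_le_mul_of_nonneg_right (by linarith) hD.le).trans (h n)
    have h4 : D = 2 / 2 ^ n * (2 ^ n / 2 * D) := by field_simp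
    rw [h4]
    refine (mul_le_mul_of_nonneg_left h3 (by positivity)).trans (le_of_eq ?_)
    field_simp
    ring
  -- For `ε = 0` no depth is optimal, and letting `n → ∞` gives `D ≤ 0`.
  rcases hε0.eq_or_lt with rfl | hpos
  · have hlim : Filter.Tendsto (fun n : ℕ => 2 * (1 / 2 : ℝ) ^ n * I) Filter.atTop
        (nhds (2 * 0 * I)) :=
      ((tendsto_pow_atTop_nhds_zero_of_lt_one (by norm_num) (by norm_num)).const_mul 2).mul_const I
    have hD : D ≤ 2 * 0 * I := by
      refine ge_of_tendsto hlim ((Filter.eventually_ge_atTop 1).mono fun n hn => ?_)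
      refine (h1 n hn).trans (le_of_eq ?_)
      rw [one_div, inv_pow]
      ring
    simpa using hD
  · have hL : 1 ≤ Real.log ε⁻¹ / Real.log 2 := by
      rw [le_div_iff₀ hlog, one_mul]
      refine Real.log_le_log two_pos ?_
      rw [le_inv_comm₀ two_pos hpos]
      linarith
    set L := Real.log ε⁻¹ / Real.log 2 with hLdef
    obtain ⟨n, hn1, hn2⟩ : ∃ n : ℕ, L ≤ n ∧ (n : ℝ) < L + 1 :=
      ⟨⌈L⌉₊, Nat.le_ceil L, Nat.ceil_lt_add_one (by linarith)⟩
    have hn : 1 ≤ n := by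
      have : (1 : ℝ) ≤ n := hL.trans hn1
      exact_mod_cast this
    have hpow : ε⁻¹ ≤ 2 ^ n := by
      rw [← Real.log_le_log_iff (by positivity) (by positivity), Real.log_pow]
      exact (div_le_iff₀ hlog).1 hn1
    have hinv : 2 / (2 : ℝ) ^ n ≤ 2 * ε := by
      rw [div_eq_mul_inv]
      exact mul_le_mul_of_nonneg_left (inv_le_of_inv_le₀ hpos hpow) two_pos.le
    refine (h1 n hn).trans (mul_le_mul_of_nonneg_right ?_ hI)
    have e1 : 10 / Real.log 2 * (ε * Real.log ε⁻¹) = ε * (10 * L) := by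
      rw [hLdef]
      ring
    rw [e1]
    -- Since `n < L + 1` and `L ≥ 1`, `2 + 4n < 6 + 4L ≤ 10L`; hence the constant 10. The bound `L ≥
    -- 1` is where `ε ≤ 1/2` enters.
    have : ε * (2 + 4 * n) ≤ ε * (10 * L) := mul_le_mul_of_nonneg_left (by linarith) hpos.le
    linarith

end DiscreteInfo

theorem theorem3 :
    ∃ C : ℝ,
      ∀ (Ω : Type*) [MeasurableSpace Ω] (μ : Measure Ω) [IsProbabilityMeasure μ]
        (S T U V : Type*)
        [Countable S] [MeasurableSpace S] [MeasurableSingletonClass S]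
        [Countable T] [MeasurableSpace T] [MeasurableSingletonClass T]
        [Countable U] [MeasurableSpace U] [MeasurableSingletonClass U]
        [Countable V] [MeasurableSpace V] [MeasurableSingletonClass V]
        (X : Ω → S) (Y : Ω → T) (A : Ω → U) (B : Ω → V),
        Measurable X → Measurable Y → Measurable A → Measurable B →
        DiscreteInfo.HasFiniteEntropy μ (fun ω => (X ω, Y ω, A ω, B ω)) →
        ∀ ε : ℝ, 0 ≤ ε → ε ≤ 1 / 2 →
          DiscreteInfo.condMutualInfo μ A X Y ≤ ε * DiscreteInfo.mutualInfo μ X Y →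
          DiscreteInfo.condMutualInfo μ A Y X ≤ ε * DiscreteInfo.mutualInfo μ X Y →
          DiscreteInfo.condMutualInfo μ B X Y ≤ ε * DiscreteInfo.mutualInfo μ X Y →
          DiscreteInfo.condMutualInfo μ B Y X ≤ ε * DiscreteInfo.mutualInfo μ X Y →
          DiscreteInfo.mutualInfo μ X Y ≤
            DiscreteInfo.condMutualInfo μ X Y A + DiscreteInfo.condMutualInfo μ X Y B
              + DiscreteInfo.mutualInfo μ A B
              + C * (ε * Real.log ε⁻¹) * DiscreteInfo.mutualInfo μ X Y := by
  refine ⟨10 / Real.log 2, ?_⟩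
  intro Ω _ μ _ S T U V _ _ _ _ _ _ _ _ _ _ _ _ X Y A B hX hY hA hB hfin ε hε0 hε hAX hAY hBX hBY
  -- Injective recoding of `A` and `B` into `ℕ` leaves all information quantities unchanged.
  obtain ⟨f, hf⟩ := exists_injective_nat U
  obtain ⟨g, hg⟩ := exists_injective_nat V
  have mA : Measurable fun ω => f (A ω) := (measurable_of_countable f).comp hA
  have mB : Measurable fun ω => g (B ω) := (measurable_of_countable g).comp hB
  have eA : ∀ ω ω', A ω = A ω' ↔ f (A ω) = f (A ω') := fun ω ω' => hf.eq_iff.symm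
  have eB : ∀ ω ω', B ω = B ω' ↔ g (B ω) = g (B ω') := fun ω ω' => hg.eq_iff.symm
  have mF : Measurable fun ω => (X ω, Y ω, A ω, B ω) := by fun_prop
  have hI : 0 ≤ DiscreteInfo.mutualInfo μ X Y := by
    have h1 : DiscreteInfo.HasFiniteEntropy μ fun ω => (X ω, Y ω) :=
      hfin.of_determines mF (by fun_prop) fun ω ω' h => by simp_all
    have h2 := DiscreteInfo.entropy_submodular (μ := μ) (F := X) (G := Y) (M := fun _ => (0 : ℕ)) h1
      hX hY (by fun_prop) measurable_const (fun ω ω' => by simp) (fun _ _ _ => rfl)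
      (fun _ _ _ => rfl)
    have h3 : DiscreteInfo.entropy μ (fun _ : Ω => (0 : ℕ)) = 0 :=
      DiscreteInfo.entropy_const 0
    simp only [DiscreteInfo.mutualInfo, DiscreteInfo.condEntropy]
    linarith
  rw [DiscreteInfo.condMutualInfo_congr hA hX hY mA hX hY eA (fun _ _ => Iff.rfl)
    (fun _ _ => Iff.rfl)] at hAX
  rw [DiscreteInfo.condMutualInfo_congr hA hY hX mA hY hX eA (fun _ _ => Iff.rfl)
    (fun _ _ => Iff.rfl)] at hAY
  rw [DiscreteInfo.condMutualInfo_congr hB hX hY mB hX hY eB (fun _ _ => Iff.rfl)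
    (fun _ _ => Iff.rfl)] at hBX
  rw [DiscreteInfo.condMutualInfo_congr hB hY hX mB hY hX eB (fun _ _ => Iff.rfl)
    (fun _ _ => Iff.rfl)] at hBY
  rw [DiscreteInfo.condMutualInfo_congr hX hY hA hX hY mA (fun _ _ => Iff.rfl)
      (fun _ _ => Iff.rfl) eA,
    DiscreteInfo.condMutualInfo_congr hX hY hB hX hY mB (fun _ _ => Iff.rfl)
      (fun _ _ => Iff.rfl) eB,
    DiscreteInfo.mutualInfo_congr hA hB mA mB eA eB]
  have hfin' : DiscreteInfo.HasFiniteEntropy μ fun ω => ((X ω, Y ω), (f (A ω), g (B ω))) :=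
    hfin.of_determines mF (by fun_prop) fun ω ω' h => by simp_all
  -- Each Markov defect is a sum of two terms bounded by `ε I(X:Y)`, so `e = 2 ε I(X:Y)`.
  have key := DiscreteInfo.le_mul_log_inv_of_doubling hI hε0 hε
    (DiscreteInfo.ingletonDefect_le_of_markovDefect_le hX hY mA mB hfin' (by positivity)
      (by unfold DiscreteInfo.markovDefect; linarith)
      (by unfold DiscreteInfo.markovDefect; linarith))
  unfold DiscreteInfo.ingletonDefect at key
  linarith
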